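/- Let $(b_n)_{n\ge 0}$ be the Baum--Sweet sequence: $b_0=1$, and for $n\ge 1$, $b_n=0$ if the binary expansion of $n$ contains a block (maximal run) of consecutive $0$'s of odd length, and $b_n=1$ otherwise. Let $$\overline{B}(X)=\sum_{n=0}^{\infty} b_nX^n\in\mathbb{C}[[X]].$$ Then $\overline{B}$ satisfies the functional equation $$\overline{B}(X^4)+X\,\overline{B}(X^2)=\overline{B}(X),$$ $\overline{B}$ is not a rational function (that is, regarded in $\mathbb{C}((X))$ it does not lie in $\mathbb{C}(X)$), and $\overline{B}$ is transcendental over $\mathbb{C}(X)$. -/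

import Mathlib

open scoped RatFunc

/-- The list `w` of binary digits contains a block (maximal run) of exactly `k` consecutive `0`s:
the run is neither preceded nor followed by another `0` in `w`. -/
def HasZeroBlock (w : List ℕ) (k : ℕ) : Prop :=
  ∃ u v : List ℕ, w = u ++ List.replicate k 0 ++ v ∧ u.getLast? ≠ some 0 ∧ v.head? ≠ some 0

open Classical in
/-- The Baum–Sweet sequence: `b n = 0` if the binary expansion of `n` contains a block of `0`s of
odd length, and `b n = 1` otherwise. Since `Nat.digits 2 0 = []`, this gives `b 0 = 1`. -/
noncomputable def baumSweet (n : ℕ) : ℕ :=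
  if ∃ k : ℕ, Odd k ∧ HasZeroBlock (Nat.digits 2 n) k then 0 else 1

/-- The generating series `∑ b n X ^ n` of the Baum–Sweet sequence, with complex coefficients. -/
noncomputable def baumSweetSeries : PowerSeries ℂ :=
  PowerSeries.mk fun n => (baumSweet n : ℂ)

open Asymptotics Filter Polynomial

/-! ### The recursion of the Baum–Sweet sequence -/

/-! Stripping low binary digits gives b(2n+1) = b(n), b(4n) = b(n), b(4n+2) = 0, which is the
functional equation read coefficientwise. For transcendence, evaluate at x_k = exp(-2^(-k)), where
x_(k+1)^2 = x_k. The equation becomes a perturbed Fibonacci recursion f_(k+2) = f_k + x_(k+2)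
f_(k+1), and the x_k tend to 1 fast enough that f_k ≍ φ^k (`baumSweetSum_dyadicPoint_isTheta`). A
nonzero polynomial with a zero of order m at 1 has size ≍ 2^(-mk) at x_k
(`eval_dyadicPoint_isTheta`). In an algebraic relation ∑ p_j f^j = 0 the j-th term is thus ≍
(2^(-m_j) φ^j)^k. These ratios are distinct because positive powers of φ are irrational, so the
largest term cannot be cancelled. Non-rationality is a special case. -/

theorem exists_odd_hasZeroBlock_one_cons (w : List ℕ) :
    (∃ k, Odd k ∧ HasZeroBlock (1 :: w) k) ↔ ∃ k, Odd k ∧ HasZeroBlock w k := by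
  refine exists_congr fun k => and_congr_right fun hk => ⟨?_, ?_⟩
  · rintro ⟨u, v, h, hu, hv⟩
    rcases u with _ | ⟨a, u⟩
    · obtain ⟨j, rfl⟩ := Nat.exists_eq_succ_of_ne_zero hk.pos.ne'
      simp [List.replicate_succ] at h
    · simp only [List.cons_append, List.cons.injEq] at h
      refine ⟨u, v, h.2, ?_, hv⟩
      rcases u with _ | ⟨b, u⟩ <;> simp_all
  · rintro ⟨u, v, rfl, hu, hv⟩
    refine ⟨1 :: u, v, rfl, ?_, hv⟩
    rcases u with _ | ⟨b, u⟩ <;> simp_all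

theorem exists_odd_hasZeroBlock_zero_cons_zero_cons (w : List ℕ) :
    (∃ k, Odd k ∧ HasZeroBlock (0 :: 0 :: w) k) ↔ ∃ k, Odd k ∧ HasZeroBlock w k := by
  constructor
  · rintro ⟨k, hk, u, v, h, hu, hv⟩
    rcases u with _ | ⟨a, _ | ⟨b, u⟩⟩
    · rcases k with _ | _ | k
      · simp at hk
      -- A leading block of length 1 is impossible: the second 0 would follow it, against
      -- maximality.
      · simp only [List.nil_append, zero_add, List.replicate_one, List.cons_append,
          List.cons.injEq, true_and] at h
        simp [← h] at hv
      · simp only [List.replicate_succ, List.nil_append, List.cons_append, List.cons.injEq,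
          true_and] at h
        exact ⟨k, by simpa [Nat.odd_add_one] using hk, [], v, by simpa using h, by simp, hv⟩
    · simp only [List.cons_append, List.cons.injEq] at h
      simp [← h.1] at hu
    · simp only [List.cons_append, List.cons.injEq] at h
      refine ⟨k, hk, u, v, h.2.2, ?_, hv⟩
      rcases u with _ | ⟨c, u⟩ <;> simp_all
  · rintro ⟨k, hk, u, v, rfl, hu, hv⟩
    rcases u with _ | ⟨a, u⟩
    · exact ⟨k + 2, by simpa [Nat.odd_add_one] using hk, [], v, by simp [List.replicate_succ],
        by simp, hv⟩
    · exact ⟨k, hk, 0 :: 0 :: a :: u, v, rfl, by simpa using hu, hv⟩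

theorem baumSweet_zero : baumSweet 0 = 1 := by
  rw [baumSweet, if_neg]
  rintro ⟨k, hk, u, v, h, -, -⟩
  simp only [Nat.digits_zero, List.nil_eq, List.append_eq_nil_iff, List.replicate_eq_nil_iff] at h
  simp [h.1.2] at hk

theorem baumSweet_two_mul_add_one (n : ℕ) : baumSweet (2 * n + 1) = baumSweet n := by
  have h : Nat.digits 2 (2 * n + 1) = 1 :: Nat.digits 2 n := by
    rw [add_comm]
    exact Nat.digits_add 2 (by norm_num) 1 n (by norm_num) (by simp)
  classical
  rw [baumSweet, baumSweet]
  exact if_congr (by rw [h, exists_odd_hasZeroBlock_one_cons]) rfl rfl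

theorem digits_two_mul {n : ℕ} (hn : n ≠ 0) : Nat.digits 2 (2 * n) = 0 :: Nat.digits 2 n := by
  simpa using Nat.digits_add 2 (by norm_num) 0 n (by norm_num) (Or.inr hn)

theorem baumSweet_four_mul (n : ℕ) : baumSweet (4 * n) = baumSweet n := by
  rcases eq_or_ne n 0 with rfl | hn
  · rfl
  · have h : Nat.digits 2 (4 * n) = 0 :: 0 :: Nat.digits 2 n := by
      rw [show 4 * n = 2 * (2 * n) by ring, digits_two_mul (by simpa using hn), digits_two_mul hn]
    classical
    rw [baumSweet, baumSweet]
    exact if_congr (by rw [h, exists_odd_hasZeroBlock_zero_cons_zero_cons]) rfl rfl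

theorem baumSweet_four_mul_add_two (n : ℕ) : baumSweet (4 * n + 2) = 0 := by
  rw [baumSweet, if_pos]
  refine ⟨1, odd_one, [], 1 :: Nat.digits 2 n, ?_, by simp, by simp⟩
  rw [show 4 * n + 2 = 2 * (2 * n + 1) by ring, digits_two_mul (by simp), add_comm,
    Nat.digits_add 2 (by norm_num) 1 n (by norm_num) (by simp)]
  simp

theorem baumSweet_le_one (n : ℕ) : baumSweet n ≤ 1 := by
  rw [baumSweet]; split_ifs <;> simp

theorem baumSweetSeries_functional_equation :
    PowerSeries.subst (PowerSeries.X ^ 4 : PowerSeries ℂ) baumSweetSeries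
        + PowerSeries.X * PowerSeries.subst (PowerSeries.X ^ 2 : PowerSeries ℂ) baumSweetSeries
      = baumSweetSeries := by
  ext n
  rw [map_add, PowerSeries.coeff_subst_X_pow (by norm_num)]
  simp only [baumSweetSeries, PowerSeries.coeff_mk, Algebra.algebraMap_self, RingHom.id_apply]
  rcases n with _ | n
  · simp
  rw [PowerSeries.coeff_succ_X_mul, PowerSeries.coeff_subst_X_pow (by norm_num)]
  simp only [PowerSeries.coeff_mk, Algebra.algebraMap_self, RingHom.id_apply]
  rcases Nat.even_or_odd' n with ⟨m, rfl | rfl⟩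
  · rw [if_neg (by omega), if_pos (by omega), Nat.mul_div_cancel_left _ two_pos,
      baumSweet_two_mul_add_one, zero_add]
  · rw [if_neg (c := 2 ∣ 2 * m + 1) (by omega), add_zero]
    rcases Nat.even_or_odd' m with ⟨l, rfl | rfl⟩
    · rw [if_neg (by omega), show 2 * (2 * l) + 1 + 1 = 4 * l + 2 by ring,
        baumSweet_four_mul_add_two, Nat.cast_zero]
    · rw [if_pos (by omega), show 2 * (2 * l + 1) + 1 + 1 = 4 * (l + 1) by ring,
        Nat.mul_div_cancel_left _ four_pos, baumSweet_four_mul]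

/-! ### Evaluation of power series -/

/-- The power series `f` converges absolutely at `x`, with sum `a`. -/
def HasEvalAt (x : ℂ) (f : PowerSeries ℂ) (a : ℂ) : Prop :=
  Summable (fun n => ‖PowerSeries.coeff n f * x ^ n‖) ∧
    HasSum (fun n => PowerSeries.coeff n f * x ^ n) a

theorem HasEvalAt.unique {x a b : ℂ} {f : PowerSeries ℂ} (ha : HasEvalAt x f a)
    (hb : HasEvalAt x f b) : a = b :=
  ha.2.unique hb.2

theorem HasEvalAt.add {x a b : ℂ} {f g : PowerSeries ℂ} (ha : HasEvalAt x f a)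
    (hb : HasEvalAt x g b) : HasEvalAt x (f + g) (a + b) := by
  refine ⟨(ha.1.add hb.1).of_nonneg_of_le (fun _ => norm_nonneg _) fun n => ?_, ?_⟩
  · rw [map_add, add_mul]
    exact norm_add_le _ _
  · simpa only [map_add, add_mul] using ha.2.add hb.2

/-- Mertens-type Cauchy product; this is where absolute convergence is needed. -/
theorem HasEvalAt.mul {x a b : ℂ} {f g : PowerSeries ℂ} (ha : HasEvalAt x f a)
    (hb : HasEvalAt x g b) : HasEvalAt x (f * g) (a * b) := by
  have key : ∀ n : ℕ, ∑ kl ∈ Finset.HasAntidiagonal.antidiagonal n,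
      (PowerSeries.coeff kl.1 f * x ^ kl.1) * (PowerSeries.coeff kl.2 g * x ^ kl.2) =
      PowerSeries.coeff n (f * g) * x ^ n := fun n => by
    rw [PowerSeries.coeff_mul, Finset.sum_mul]
    refine Finset.sum_congr rfl fun kl hkl => ?_
    rw [← Finset.HasAntidiagonal.mem_antidiagonal.mp hkl, pow_add]
    ring
  have hs := summable_norm_sum_mul_antidiagonal_of_summable_norm ha.1 hb.1
  have ht := tsum_mul_tsum_eq_tsum_sum_antidiagonal_of_summable_norm ha.1 hb.1
  simp only [key] at hs ht
  refine ⟨hs, ?_⟩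
  rw [← ha.2.tsum_eq, ← hb.2.tsum_eq, ht]
  exact hs.of_norm.hasSum

theorem hasEvalAt_coe (x : ℂ) (p : ℂ[X]) : HasEvalAt x (p : PowerSeries ℂ) (p.eval x) := by
  have h0 : ∀ n ∉ p.support, PowerSeries.coeff n (p : PowerSeries ℂ) * x ^ n = 0 := fun n hn => by
    rw [Polynomial.coeff_coe, notMem_support_iff.mp hn, zero_mul]
  refine ⟨summable_of_ne_finset_zero (s := p.support) fun n hn => by rw [h0 n hn, norm_zero], ?_⟩
  rw [eval_eq_sum, Polynomial.sum]
  simpa only [Polynomial.coeff_coe] using hasSum_sum_of_ne_finset_zero h0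

theorem HasEvalAt.pow {x a : ℂ} {f : PowerSeries ℂ} (ha : HasEvalAt x f a) (n : ℕ) :
    HasEvalAt x (f ^ n) (a ^ n) := by
  induction n with
  | zero => simpa using hasEvalAt_coe x 1
  | succ n ih => simpa only [pow_succ] using ih.mul ha

theorem HasEvalAt.eval₂ {x a : ℂ} {f : PowerSeries ℂ} (ha : HasEvalAt x f a) (P : ℂ[X][X]) :
    HasEvalAt x (P.eval₂ (coeToPowerSeries.ringHom (R := ℂ)) f) (P.eval₂ (evalRingHom x) a) := by
  induction P using Polynomial.induction_on' with
  | add p q hp hq => simpa only [eval₂_add] using hp.add hq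
  | monomial n p =>
    simpa only [eval₂_monomial, coeToPowerSeries.ringHom_apply, coe_evalRingHom] using
      (hasEvalAt_coe x p).mul (ha.pow n)

/-- A power series that is algebraic over the rational functions satisfies a polynomial equation
at every point of absolute convergence. -/
theorem exists_polynomial_of_isAlgebraic {f : PowerSeries ℂ}
    (hf : IsAlgebraic (RatFunc ℂ) (f : LaurentSeries ℂ)) :
    ∃ P : ℂ[X][X], P ≠ 0 ∧ ∀ x a : ℂ, HasEvalAt x f a → P.eval₂ (evalRingHom x) a = 0 := by
  -- Clearing denominators makes the coefficients polynomials, which can be evaluated everywhere.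
  obtain ⟨P, hP, h⟩ := (IsFractionRing.isAlgebraic_iff ℂ[X] (RatFunc ℂ) (LaurentSeries ℂ)).mpr hf
  refine ⟨P, hP, fun x a ha => ?_⟩
  have hz : P.eval₂ (coeToPowerSeries.ringHom (R := ℂ)) f = 0 := by
    apply HahnSeries.ofPowerSeries_injective (Γ := ℤ) (R := ℂ)
    rw [map_zero, hom_eval₂, ← h, aeval_def]
    congr 1
  have hz' := ha.eval₂ P
  rw [hz] at hz'
  exact hz'.unique (by simpa using hasEvalAt_coe x 0)

/-! ### Growth of the generating series near `1` -/

/-- The sum of the Baum–Sweet series at a real point. -/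
noncomputable def baumSweetSum (x : ℝ) : ℝ := ∑' n, (baumSweet n : ℝ) * x ^ n

theorem summable_baumSweet {x : ℝ} (h0 : 0 ≤ x) (h1 : x < 1) :
    Summable fun n => (baumSweet n : ℝ) * x ^ n :=
  (summable_geometric_of_lt_one h0 h1).of_nonneg_of_le (fun _ => by positivity) fun n =>
    mul_le_of_le_one_left (by positivity) (by exact_mod_cast baumSweet_le_one n)

theorem hasEvalAt_baumSweetSeries {x : ℝ} (h0 : 0 ≤ x) (h1 : x < 1) :
    HasEvalAt (x : ℂ) baumSweetSeries (baumSweetSum x : ℂ) := by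
  have hs := summable_baumSweet h0 h1
  have key : ∀ n, PowerSeries.coeff n baumSweetSeries * (x : ℂ) ^ n =
      (((baumSweet n : ℝ) * x ^ n : ℝ) : ℂ) := fun n => by simp [baumSweetSeries]
  simp only [HasEvalAt, key]
  exact ⟨by simpa only [Complex.norm_real] using hs.norm, Complex.hasSum_ofReal.mpr hs.hasSum⟩

theorem baumSweetSum_eq {x : ℝ} (h0 : 0 ≤ x) (h1 : x < 1) :
    baumSweetSum x = baumSweetSum (x ^ 4) + x * baumSweetSum (x ^ 2) := by
  have hs := summable_baumSweet h0 h1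
  have he : Summable fun n => (baumSweet (2 * n) : ℝ) * x ^ (2 * n) :=
    hs.comp_injective (mul_right_injective₀ (two_ne_zero (α := ℕ)))
  have ho : Summable fun n => (baumSweet (2 * n + 1) : ℝ) * x ^ (2 * n + 1) :=
    hs.comp_injective ((add_left_injective 1).comp
    (mul_right_injective₀ (two_ne_zero (α := ℕ))))
  have h4 : ∀ n, (baumSweet (2 * (2 * n)) : ℝ) * x ^ (2 * (2 * n)) =
      baumSweet n * (x ^ 4) ^ n := fun n => by
    rw [← mul_assoc, two_mul 2, baumSweet_four_mul, pow_mul]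
  have h42 : ∀ n, (baumSweet (2 * (2 * n + 1)) : ℝ) * x ^ (2 * (2 * n + 1)) = 0 := fun n => by
    rw [show 2 * (2 * n + 1) = 4 * n + 2 by ring, baumSweet_four_mul_add_two, Nat.cast_zero,
      zero_mul]
  have h2 : ∀ n, (baumSweet (2 * n + 1) : ℝ) * x ^ (2 * n + 1) =
      x * (baumSweet n * (x ^ 2) ^ n) := fun n => by
    rw [baumSweet_two_mul_add_one, pow_succ, pow_mul]
    ring
  have heven : ∑' n, (baumSweet (2 * n) : ℝ) * x ^ (2 * n) = baumSweetSum (x ^ 4) := by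
    rw [← tsum_even_add_odd (f := fun n => (baumSweet (2 * n) : ℝ) * x ^ (2 * n))]
    · simp only [h4, h42, tsum_zero, add_zero, baumSweetSum]
    · simpa only [h4] using summable_baumSweet (pow_nonneg h0 4) (pow_lt_one₀ h0 h1 four_ne_zero)
    · simpa only [h42] using summable_zero
  have hodd : ∑' n, (baumSweet (2 * n + 1) : ℝ) * x ^ (2 * n + 1) = x * baumSweetSum (x ^ 2) := by
    simp only [h2, baumSweetSum, tsum_mul_left]
  rw [← heven, ← hodd, baumSweetSum]
  exact (tsum_even_add_odd (f := fun n => (baumSweet n : ℝ) * x ^ n) he ho).symm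

theorem one_le_baumSweetSum {x : ℝ} (h0 : 0 ≤ x) (h1 : x < 1) : 1 ≤ baumSweetSum x := by
  have := (summable_baumSweet h0 h1).le_tsum 0 fun _ _ => by positivity
  simpa [baumSweet_zero, baumSweetSum] using this

/-- A sequence of points in `(0, 1)` converging to `1`, each the square of the next one. -/
noncomputable def dyadicPoint (k : ℕ) : ℝ := Real.exp (-(1 / 2) ^ k)

theorem dyadicPoint_nonneg (k : ℕ) : 0 ≤ dyadicPoint k := (Real.exp_pos _).le

theorem dyadicPoint_lt_one (k : ℕ) : dyadicPoint k < 1 :=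
  Real.exp_lt_one_iff.mpr (neg_neg_of_pos (by positivity))

theorem dyadicPoint_succ_sq (k : ℕ) : dyadicPoint (k + 1) ^ 2 = dyadicPoint k := by
  rw [dyadicPoint, dyadicPoint, ← Real.exp_nat_mul]
  congr 1
  push_cast
  ring

theorem baumSweetSum_dyadicPoint (k : ℕ) :
    baumSweetSum (dyadicPoint (k + 2)) =
      baumSweetSum (dyadicPoint k) + dyadicPoint (k + 2) * baumSweetSum (dyadicPoint (k + 1)) := by
  rw [baumSweetSum_eq (dyadicPoint_nonneg _) (dyadicPoint_lt_one _), dyadicPoint_succ_sq,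
    show dyadicPoint (k + 2) ^ 4 = (dyadicPoint (k + 2) ^ 2) ^ 2 by ring, dyadicPoint_succ_sq,
    dyadicPoint_succ_sq]

theorem one_sub_dyadicPoint_isTheta :
    (fun k => 1 - dyadicPoint k) =Θ[atTop] fun k => ((1 / 2 : ℝ)) ^ k := by
  have hpos : ∀ k, 0 < 1 - dyadicPoint k := fun k => sub_pos.mpr (dyadicPoint_lt_one k)
  constructor
  · refine IsBigO.of_bound 1 (Eventually.of_forall fun k => ?_)
    rw [Real.norm_of_nonneg (hpos k).le, Real.norm_of_nonneg (by positivity), one_mul]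
    have := Real.add_one_le_exp (-(1 / 2 : ℝ) ^ k)
    rw [dyadicPoint]
    linarith
  · refine IsBigO.of_bound 2 (Eventually.of_forall fun k => ?_)
    rw [Real.norm_of_nonneg (hpos k).le, Real.norm_of_nonneg (by positivity)]
    set t : ℝ := (1 / 2) ^ k with ht
    have ht0 : 0 < t := by positivity
    have ht1 : t ≤ 1 := pow_le_one₀ (by norm_num) (by norm_num)
    have h1 := Real.add_one_le_exp t
    have h2 : dyadicPoint k * Real.exp t = 1 := by
      rw [dyadicPoint, ← Real.exp_add, neg_add_cancel, Real.exp_zero]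
    have h3 := mul_le_mul_of_nonneg_left h1 (dyadicPoint_nonneg k)
    -- With x = `dyadicPoint k`, `h3` gives xt ≤ 1 - x, so t = xt + (1 - x)t ≤ 2(1 - x) as t ≤ 1.
    nlinarith [hpos k]

theorem tendsto_dyadicPoint : Tendsto dyadicPoint atTop (nhds 1) := by
  have h : Tendsto (fun k : ℕ => (1 / 2 : ℝ) ^ k) atTop (nhds 0) :=
    tendsto_pow_atTop_nhds_zero_of_lt_one (by norm_num) (by norm_num)
  simpa only [neg_zero, Real.exp_zero] using! (Real.continuous_exp.tendsto _).comp h.neg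

/-- Bounding the factor x_(k+2) by 1 leaves the Fibonacci recursion, which φ^k solves since φ² = φ +
1. -/
theorem exists_baumSweetSum_dyadicPoint_le :
    ∃ C : ℝ, ∀ k, baumSweetSum (dyadicPoint k) ≤ C * Real.goldenRatio ^ k := by
  set C := max (baumSweetSum (dyadicPoint 0)) (baumSweetSum (dyadicPoint 1))
  have hC : 0 ≤ C := (zero_le_one.trans
    (one_le_baumSweetSum (dyadicPoint_nonneg 0) (dyadicPoint_lt_one 0))).trans (le_max_left _ _)
  refine ⟨C, fun k => ?_⟩
  induction k using Nat.twoStepInduction with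
  | zero => rw [pow_zero, mul_one]; exact le_max_left _ _
  | one =>
    exact (le_max_right _ _).trans
      (le_mul_of_one_le_right hC (by simpa using Real.one_lt_goldenRatio.le))
  | more k ih0 ih1 =>
    rw [baumSweetSum_dyadicPoint, pow_add, Real.goldenRatio_sq]
    have hf := one_le_baumSweetSum (dyadicPoint_nonneg (k + 1)) (dyadicPoint_lt_one (k + 1))
    have h := mul_le_of_le_one_left (zero_le_one.trans hf) (dyadicPoint_lt_one (k + 2)).le
    rw [pow_succ] at ih1
    linarith

theorem exists_le_baumSweetSum_dyadicPoint :
    ∃ c : ℝ, 0 < c ∧ ∀ k, c * Real.goldenRatio ^ k ≤ baumSweetSum (dyadicPoint k) := by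
  have hφ := Real.goldenRatio_pos
  -- Chosen so that the strengthened bound below is φ⁻¹ ≤ 1 at k = 0 and exp(-1/2) ≤ 1 at k = 1.
  refine ⟨Real.exp (-1) * Real.goldenRatio⁻¹, by positivity, fun k => ?_⟩
  set c : ℝ := Real.exp (-1) * Real.goldenRatio⁻¹ with hc
  have hc0 : 0 < c := by positivity
  -- The factor `exp (2⁻ᵏ)` compensates for the losses in the recursion.
  suffices h : c * Real.goldenRatio ^ k * Real.exp ((1 / 2) ^ k) ≤
      baumSweetSum (dyadicPoint k) from
    (le_mul_of_one_le_right (by positivity) (Real.one_le_exp (by positivity))).trans h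
  have h1 : ∀ k, 1 ≤ baumSweetSum (dyadicPoint k) := fun k =>
    one_le_baumSweetSum (dyadicPoint_nonneg k) (dyadicPoint_lt_one k)
  induction k using Nat.twoStepInduction with
  | zero =>
    refine le_trans ?_ (h1 0)
    rw [hc, pow_zero, pow_zero, mul_one, mul_right_comm, ← Real.exp_add, neg_add_cancel,
      Real.exp_zero, one_mul]
    exact inv_le_one_of_one_le₀ Real.one_lt_goldenRatio.le
  | one =>
    refine le_trans ?_ (h1 1)
    rw [hc, pow_one, pow_one, inv_mul_cancel_right₀ hφ.ne', ← Real.exp_add]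
    exact Real.exp_le_one_iff.mpr (by norm_num)
  | more k ih0 ih1 =>
    set E : ℝ := Real.exp ((1 / 2) ^ (k + 1)) with hE
    have hx : dyadicPoint (k + 2) * E = Real.exp ((1 / 2) ^ (k + 2)) := by
      rw [dyadicPoint, hE, ← Real.exp_add]
      congr 1
      ring
    have hEk : E ≤ Real.exp ((1 / 2) ^ k) :=
      Real.exp_le_exp.mpr (pow_le_pow_of_le_one (by norm_num) (by norm_num) k.le_succ)
    have hx0 := dyadicPoint_nonneg (k + 2)
    have h0 : dyadicPoint (k + 2) * (c * Real.goldenRatio ^ k * E) ≤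
        baumSweetSum (dyadicPoint k) := calc
      _ ≤ c * Real.goldenRatio ^ k * E :=
        mul_le_of_le_one_left (by positivity) (dyadicPoint_lt_one _).le
      _ ≤ c * Real.goldenRatio ^ k * Real.exp ((1 / 2) ^ k) := by gcongr
      _ ≤ _ := ih0
    have h1 := mul_le_mul_of_nonneg_left ih1 hx0
    rw [baumSweetSum_dyadicPoint, ← hx, pow_add, Real.goldenRatio_sq]
    rw [pow_succ] at h1
    linarith

theorem baumSweetSum_dyadicPoint_isTheta :
    (fun k => baumSweetSum (dyadicPoint k)) =Θ[atTop] fun k => Real.goldenRatio ^ k := by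
  have hφ := Real.goldenRatio_pos
  obtain ⟨C, hC⟩ := exists_baumSweetSum_dyadicPoint_le
  obtain ⟨c, hc0, hc⟩ := exists_le_baumSweetSum_dyadicPoint
  have hf : ∀ k, 0 ≤ baumSweetSum (dyadicPoint k) := fun k =>
    zero_le_one.trans (one_le_baumSweetSum (dyadicPoint_nonneg k) (dyadicPoint_lt_one k))
  constructor
  · refine IsBigO.of_bound C (Eventually.of_forall fun k => ?_)
    rw [Real.norm_of_nonneg (hf k), Real.norm_of_nonneg (by positivity)]
    exact hC k
  · refine IsBigO.of_bound c⁻¹ (Eventually.of_forall fun k => ?_)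
    rw [Real.norm_of_nonneg (hf k), Real.norm_of_nonneg (by positivity),
      le_inv_mul_iff₀ hc0]
    exact hc k

/-! ### Transcendence -/

/-- The power is F_(n+1) φ + F_n with F_(n+1) nonzero. -/
theorem irrational_goldenRatio_pow_succ (n : ℕ) : Irrational (Real.goldenRatio ^ (n + 1)) := by
  rw [← Real.goldenRatio_mul_fib_succ_add_fib]
  exact (Real.goldenRatio_irrational.mul_natCast (Nat.fib_pos.mpr n.succ_pos).ne').add_natCast _

/-- A coincidence at i < j would make φ^(j-i) a quotient of powers of 1/2, hence rational. -/
theorem injective_half_pow_mul_goldenRatio_pow (m : ℕ → ℕ) :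
    Function.Injective fun j => (1 / 2 : ℝ) ^ m j * Real.goldenRatio ^ j := by
  refine Function.Injective.of_lt_imp_ne fun i j hij h => ?_
  obtain ⟨d, rfl⟩ := Nat.exists_eq_add_of_lt hij
  refine irrational_goldenRatio_pow_succ d ⟨(1 / 2) ^ m i / (1 / 2) ^ m (i + d + 1), ?_⟩
  have hφ : Real.goldenRatio ^ i ≠ 0 := pow_ne_zero _ Real.goldenRatio_ne_zero
  push_cast
  rw [div_eq_iff (by positivity)]
  apply mul_right_cancel₀ hφ
  rw [h]
  ring

/-- A finite sum of sequences growing like geometric sequences with distinct ratios does not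
vanish identically. -/
theorem not_forall_sum_eq_zero_of_isTheta_pow {ι : Type*} {s : Finset ι} (hs : s.Nonempty)
    {u : ι → ℕ → ℂ} {ρ : ι → ℝ} (hρ : Set.InjOn ρ s) (hpos : ∀ i ∈ s, 0 < ρ i)
    (hu : ∀ i ∈ s, u i =Θ[atTop] fun k => ρ i ^ k) : ¬ ∀ k, ∑ i ∈ s, u i k = 0 := by
  classical
  intro h
  obtain ⟨j, hj, hmax⟩ := s.exists_max_image ρ hs
  have hlittle : (fun k => ∑ i ∈ s.erase j, u i k) =o[atTop] fun k => ρ j ^ k := by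
    refine IsLittleO.fun_sum fun i hi => ?_
    obtain ⟨hij, hi⟩ := Finset.mem_erase.mp hi
    exact (hu i hi).1.trans_isLittleO (isLittleO_pow_pow_of_lt_left (hpos i hi).le
      (lt_of_le_of_ne (hmax i hi) fun e => hij (hρ hi hj e)))
  -- The vanishing sum makes the dominant term equal to minus the others, hence negligible against
  -- itself.
  have heq : u j = fun k => -∑ i ∈ s.erase j, u i k := funext fun k => by
    rw [eq_neg_iff_add_eq_zero, Finset.add_sum_erase s (fun i => u i k) hj, h k]
  have hself : (fun k => ρ j ^ k) =o[atTop] fun k => ρ j ^ k :=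
    (hu j hj).2.trans_isLittleO (heq ▸ hlittle.neg_left)
  exact isLittleO_irrefl (Frequently.of_forall fun k => pow_ne_zero k (hpos j hj).ne') hself

/-- Split off the full power of X - 1: the cofactor tends to a nonzero limit, and |x_k - 1| ≍
2^(-k). -/
theorem eval_dyadicPoint_isTheta {p : ℂ[X]} (hp : p ≠ 0) :
    (fun k => p.eval (dyadicPoint k : ℂ)) =Θ[atTop]
      fun k => ((1 / 2 : ℝ) ^ p.rootMultiplicity 1) ^ k := by
  obtain ⟨q, hq, hdvd⟩ := exists_eq_pow_rootMultiplicity_mul_and_not_dvd p hp 1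
  have hq1 : q.eval 1 ≠ 0 := fun h => hdvd (dvd_iff_isRoot.mpr h)
  have hlim : Tendsto (fun k => q.eval (dyadicPoint k : ℂ)) atTop (nhds (q.eval 1)) := by
    have h1 : Tendsto (fun k => (dyadicPoint k : ℂ)) atTop (nhds 1) := by
      simpa only [Complex.ofReal_one] using!
        (Complex.continuous_ofReal.tendsto 1).comp tendsto_dyadicPoint
    exact (q.continuous.tendsto 1).comp h1
  have hqΘ : (fun k => q.eval (dyadicPoint k : ℂ)) =Θ[atTop] fun _ => (1 : ℝ) :=
    (isTheta_of_div_tendsto_nhds_ne_zero (f := fun _ => (1 : ℂ)) (by simpa using hlim) hq1).symm.trans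
      (isTheta_const_const one_ne_zero one_ne_zero)
  have hx : (fun k => (dyadicPoint k : ℂ) - 1) =Θ[atTop] fun k => (1 / 2 : ℝ) ^ k := by
    refine IsTheta.trans (IsTheta.of_norm_eventuallyEq_norm (Eventually.of_forall fun k => ?_))
      one_sub_dyadicPoint_isTheta
    simp only
    rw [norm_sub_rev, ← Complex.ofReal_one, ← Complex.ofReal_sub, Complex.norm_real]
  have := (hx.pow (p.rootMultiplicity 1)).mul hqΘ
  refine IsTheta.trans (EventuallyEq.isTheta (Eventually.of_forall fun k => ?_))
    (this.trans (EventuallyEq.isTheta (Eventually.of_forall fun k => ?_)))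
  · conv_lhs => rw [hq]
    simp
  · simp only [mul_one]
    rw [← pow_mul, ← pow_mul, mul_comm]

theorem transcendental_baumSweetSeries :
    Transcendental (RatFunc ℂ) (baumSweetSeries : LaurentSeries ℂ) := by
  intro halg
  obtain ⟨P, hP, h⟩ := exists_polynomial_of_isAlgebraic halg
  refine not_forall_sum_eq_zero_of_isTheta_pow (s := P.support)
    (u := fun j k => (P.coeff j).eval (dyadicPoint k : ℂ) *
      (baumSweetSum (dyadicPoint k) : ℂ) ^ j)
    (ρ := fun j => (1 / 2 : ℝ) ^ (P.coeff j).rootMultiplicity 1 * Real.goldenRatio ^ j)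
    (support_nonempty.mpr hP)
    (injective_half_pow_mul_goldenRatio_pow fun j => (P.coeff j).rootMultiplicity 1).injOn
    (fun j _ => by have := Real.goldenRatio_pos; positivity) (fun j hj => ?_) fun k => ?_
  · have hf : (fun k => (baumSweetSum (dyadicPoint k) : ℂ)) =Θ[atTop]
        fun k => Real.goldenRatio ^ k :=
      IsTheta.trans (IsTheta.of_norm_eventuallyEq_norm
        (Eventually.of_forall fun k => Complex.norm_real _)) baumSweetSum_dyadicPoint_isTheta
    have := (eval_dyadicPoint_isTheta (mem_support_iff.mp hj)).mul (hf.pow j)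
    refine this.trans (EventuallyEq.isTheta (Eventually.of_forall fun k => ?_))
    simp only
    rw [mul_pow, ← pow_mul, ← pow_mul Real.goldenRatio, mul_comm k j, pow_mul Real.goldenRatio]
  · have := h _ _ (hasEvalAt_baumSweetSeries (dyadicPoint_nonneg k) (dyadicPoint_lt_one k))
    rwa [eval₂_eq_sum, Polynomial.sum] at this

theorem mainTheorem12 :
    PowerSeries.subst (PowerSeries.X ^ 4 : PowerSeries ℂ) baumSweetSeries
        + PowerSeries.X * PowerSeries.subst (PowerSeries.X ^ 2 : PowerSeries ℂ) baumSweetSeries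
      = baumSweetSeries ∧
    (¬ ∃ r : RatFunc ℂ,
      algebraMap (RatFunc ℂ) (LaurentSeries ℂ) r = (baumSweetSeries : LaurentSeries ℂ)) ∧
    Transcendental (RatFunc ℂ) (baumSweetSeries : LaurentSeries ℂ) :=

  ⟨baumSweetSeries_functional_equation,
    fun ⟨r, hr⟩ => transcendental_baumSweetSeries (hr ▸ isAlgebraic_algebraMap r),
    transcendental_baumSweetSeries⟩
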